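/- Let $m_1,\dots,m_l$ be odd positive integers, $R_i=\mathbb{Z}_4[x]/\langle x^{m_i}-1\rangle$ and $R=R_1\times\cdots\times R_l$, and identify $(c_{1,0},\dots,c_{1,m_1-1}|\cdots|c_{l,0},\dots,c_{l,m_l-1})\in\mathbb{Z}_4^{m_1}\times\cdots\times\mathbb{Z}_4^{m_l}$ with $(c_1(x)|\cdots|c_l(x))\in R$, $c_i(x)=\sum_j c_{i,j}x^j$. A generalized quasi-cyclic (GQC) code $\mathcal C$ is a $\mathbb{Z}_4$-linear code that is closed under the simultaneous cyclic shift of all blocks, i.e. a $\mathbb{Z}_4[x]$-submodule of $R$; $\mathcal C^\perp$ is its dual for the Euclidean inner product; ${}_{(i)}\mathcal C$ is its truncation to the first $i$ blocks. A normalized generating set of $\mathcal C$ consists of vectors $\mathbf a_r=(F_{r,1}|\cdots|F_{r,r}|0|\cdots|0)$, $1\le r\le l$, with $F_{r,s}\in\mathbb{Z}_4[x]$, that generate $\mathcal C$, such that $F_{r,r}$ generates the ideal of $R_r$ formed by the $r$-th components of the codewords that vanish in all blocks after the $r$-th, and such that $F_{r,r}=f_r+2g_r$, where $f_r$ is a monic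 divisor of $x^{m_r}-1$ and $g_r$ is $0$ or a monic divisor of $f_r$. Write $\overline f$ for the reduction of $f$ modulo $2$ and $f^*(x)=x^{\deg f}f(1/x)$. For polynomials $f=\prod_j h_j^{e_j}$ and $g=\prod_j h_j^{t_j}$ with $e_j,t_j\in\{0,1\}$ and pairwise coprime monic $h_j\in\mathbb{Z}_4[x]$ such that all $\overline h_j$ are irreducible, put $\gcd_4(f,g)=\prod_j h_j^{\min(e_j,t_j)}$; $\gcd_4(f,g)$ is defined only for such $f,g$. Let $(F_{r,s})$ and $(E_{r,s})$ be the coefficients of normalized generating sets of $\mathcal C$ and of $\mathcal C^\perp$. For each $i$ let $\mathbf g_1,\dots,\mathbf g_i$, $\mathbf g_r=(G_{r,1}|\cdots|G_{r,r}|0|\cdots|0)$, be a normalized generating set of ${}_{(i)}\mathcal C$ (it depends on $i$) in which every $G_{r,r}$ is monic and $\overline G_{r,r}$ has no multiple roots. Put $\mathbf g_i^{(0)}=\mathbf g_i$, $A_{i,i}^{(0)}=G_{i,i}$ and, for $k=1,\dots,i-1$, $$A_{i,i-k}^{(k)}=\frac{G_{i-k,i-k}}{\gcd_4\bigl(G_{i-k,i-k},G_{i,i-k}^{(k-1)}\bigr)},\qquad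 B_{i,i-k}^{(k)}=\frac{G_{i,i-k}^{(k-1)}}{\gcd_4\bigl(G_{i-k,i-k},G_{i,i-k}^{(k-1)}\bigr)},$$ $$\mathbf g_i^{(k)}=A_{i,i-k}^{(k)}\,\mathbf g_i^{(k-1)}-B_{i,i-k}^{(k)}\,\mathbf g_{i-k}=\bigl(G_{i,1}^{(k)}|\cdots|G_{i,i}^{(k)}\bigr)\quad\text{in }R_1\times\cdots\times R_i,$$ where $G_{i,j}^{(0)}=G_{i,j}$ and, for $k\ge1$, the polynomials $G_{i,j}^{(k)}$ are any representatives of the entries; finally put $G_{i,i}^{(i-1)}=A_{i,i}^{(0)}A_{i,i-1}^{(1)}\cdots A_{i,1}^{(i-1)}$. Assume that $F_{i,i}\mid x^{m_i}-1$ for $i=1,\dots,l$, and that for $i=2,\dots,l$ and $k=0,\dots,i-2$ the polynomial $G_{i,i-k-1}^{(k)}$ is monic, its reduction modulo $2$ has no multiple roots, and $\gcd_4\bigl(G_{i-k-1,i-k-1},G_{i,i-k-1}^{(k)}\bigr)$ is defined. Then $$E_{i,i}\,\bigl(G_{i,i}^{(i-1)}\bigr)^*=x^{m_i}-1\quad\text{or}\quad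 E_{i,i}\,\bigl(G_{i,i}^{(i-1)}\bigr)^*=1-x^{m_i}\qquad\text{for every } i=1,\dots,l.$$ -/

import Mathlib

open Polynomial

noncomputable section

namespace GQC

/-- Words of `ℤ₄^{m₁} × ⋯ × ℤ₄^{m_l}`. -/
abbrev Word {l : ℕ} (m : Fin l → ℕ) : Type := (i : Fin l) → Fin (m i) → ZMod 4

/-- The simultaneous cyclic shift of all blocks, `(c₀, …, c_{m-1}) ↦ (c_{m-1}, c₀, …, c_{m-2})`
in each block. -/
def shift {l : ℕ} {m : Fin l → ℕ} (c : Word m) : Word m :=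
  fun i j => c i ((finRotate (m i)).symm j)

/-- A `ℤ₄`-linear code of block lengths `m` is generalized quasi-cyclic. -/
def IsGQC {l : ℕ} {m : Fin l → ℕ} (C : Submodule (ZMod 4) (Word m)) : Prop :=
  ∀ c ∈ C, shift c ∈ C

/-- The Euclidean inner product of two words. -/
def dot {l : ℕ} {m : Fin l → ℕ} (d c : Word m) : ZMod 4 :=
  ∑ i, ∑ j, d i j * c i j

/-- The dual code `C^⊥`. -/
def dualCode {l : ℕ} {m : Fin l → ℕ} (C : Submodule (ZMod 4) (Word m)) :
    Submodule (ZMod 4) (Word m) where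
  carrier := {d | ∀ c ∈ C, dot d c = 0}
  zero_mem' := by
    intro c _
    simp [dot]
  add_mem' := by
    intro a b ha hb c hc
    have h1 : dot a c = 0 := ha c hc
    have h2 : dot b c = 0 := hb c hc
    have h : dot (a + b) c = dot a c + dot b c := by
      simp [dot, add_mul, Finset.sum_add_distrib]
    rw [h, h1, h2, add_zero]
  smul_mem' := by
    intro t a ha c hc
    have h1 : dot a c = 0 := ha c hc
    have h : dot (t • a) c = t * dot a c := by
      simp [dot, Finset.mul_sum, mul_assoc]
    rw [h, h1, mul_zero]

/-- The ring `ℤ₄[x] / ⟨x^n - 1⟩`. -/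
abbrev Block (n : ℕ) : Type := (ZMod 4)[X] ⧸ Ideal.span {(X ^ n - 1 : (ZMod 4)[X])}

/-- The `ℤ₄[x]`-module `R = R₁ × ⋯ × R_l`. -/
abbrev Ambient {l : ℕ} (m : Fin l → ℕ) : Type := (i : Fin l) → Block (m i)

/-- The identification `φ` of words with elements of `R`,
`(c_{i,j}) ↦ (∑ⱼ c_{1,j} xʲ | ⋯ | ∑ⱼ c_{l,j} xʲ)`. -/
def toAmbient {l : ℕ} {m : Fin l → ℕ} (c : Word m) : Ambient m :=
  fun i => Ideal.Quotient.mk _ (∑ j : Fin (m i), Polynomial.C (c i j) * X ^ (j : ℕ))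

/-- The element of `R` represented by a vector of polynomials. -/
def ofPolys {l : ℕ} (m : Fin l → ℕ) (p : Fin l → (ZMod 4)[X]) : Ambient m :=
  fun i => Ideal.Quotient.mk _ (p i)

/-- Normal form `f + 2g` of a generator of a cyclic code of length `n` over `ℤ₄`:
`f` is a monic divisor of `x^n - 1` and `g` is a monic divisor of `f`; the term `2g` may also be
absent (`⟨f⟩` is generated by `f` as well as by `f + 2f = -f`). -/
def IsCyclicNormalForm (n : ℕ) (p : (ZMod 4)[X]) : Prop :=
  ∃ f g : (ZMod 4)[X], p = f + 2 * g ∧ f.Monic ∧ f ∣ X ^ n - 1 ∧ (g = 0 ∨ (g.Monic ∧ g ∣ f))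

/-- The vectors `(F_{1,1} | 0 | ⋯ | 0)`, …, `(F_{l,1} | ⋯ | F_{l,l})` form a normalized generating
set of `C`.  The last field is what makes the set normalized: `F_{i,i}` generates the cyclic code
formed by the `i`-th blocks of the codewords that vanish in all blocks after the `i`-th. -/
structure IsNormalizedGeneratingSet {l : ℕ} {m : Fin l → ℕ}
    (C : Submodule (ZMod 4) (Word m)) (F : Fin l → Fin l → (ZMod 4)[X]) : Prop where
  lower : ∀ i j, i < j → F i j = 0
  diag : ∀ i, IsCyclicNormalForm (m i) (F i i)
  generates : ∀ c : Word m, c ∈ C ↔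
    toAmbient c ∈ Submodule.span (ZMod 4)[X] (Set.range fun i => ofPolys m (F i))
  leading : ∀ i, ∀ c ∈ C, (∀ j, i < j → c j = 0) →
    toAmbient c i ∈ Ideal.span {(Ideal.Quotient.mk _ (F i i) : Block (m i))}

/-- The lengths of the blocks up to and including the block `i`. -/
def truncLengths {l : ℕ} (m : Fin l → ℕ) (i : Fin l) : Fin (i + 1) → ℕ :=
  fun j => m (Fin.castLE i.isLt j)

/-- Truncation of a word to its blocks up to and including the block `i`. -/
def truncate {l : ℕ} (m : Fin l → ℕ) (i : Fin l) :
    Word m →ₗ[ZMod 4] Word (truncLengths m i) where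
  toFun c := fun j => c (Fin.castLE i.isLt j)
  map_add' _ _ := rfl
  map_smul' _ _ := rfl

/-- The truncated code. -/
def truncatedCode {l : ℕ} {m : Fin l → ℕ} (C : Submodule (ZMod 4) (Word m)) (i : Fin l) :
    Submodule (ZMod 4) (Word (truncLengths m i)) :=
  C.map (truncate m i)

/-- Reduction of polynomials modulo 2. -/
def red (p : (ZMod 4)[X]) : (ZMod 2)[X] :=
  p.map (ZMod.castHom (by norm_num : 2 ∣ 4) (ZMod 2))

/-- `p` is monic, and its reduction modulo 2 has no multiple roots. -/
def MonicNoMultipleRoots (p : (ZMod 4)[X]) : Prop :=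
  p.Monic ∧ (red p).Separable

/-- `d = gcd₄(f, g)`: there are pairwise coprime monic basic irreducible polynomials `h_j` with
`f = ∏ h_j^{e_j}`, `g = ∏ h_j^{t_j}`, `d = ∏ h_j^{min(e_j, t_j)}` and exponents in `{0, 1}`. -/
def IsGcdFour (f g d : (ZMod 4)[X]) : Prop :=
  ∃ (r : ℕ) (h : Fin r → (ZMod 4)[X]) (e t : Fin r → ℕ),
    (∀ j, (h j).Monic ∧ Irreducible (red (h j))) ∧
    (∀ j k, j ≠ k → IsCoprime (h j) (h k)) ∧
    (∀ j, e j ≤ 1 ∧ t j ≤ 1) ∧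
    f = ∏ j, h j ^ e j ∧ g = ∏ j, h j ^ t j ∧ d = ∏ j, h j ^ min (e j) (t j)

/-- The column `r - k - 1` that is cleared when one passes from `g_r^{(k)}` to `g_r^{(k+1)}`. -/
def pivot {N : ℕ} (r : Fin N) (k : ℕ) : Fin N :=
  ⟨r - k - 1, lt_of_le_of_lt (by omega : (r : ℕ) - k - 1 ≤ r) r.isLt⟩

/-- `P k j = G_{r,j}^{(k)}`, `A k = A_{r,r-k}^{(k)}` and `B k = B_{r,r-k}^{(k)}` are the polynomials
produced by the elimination of the row `r` of `G`: `g_r^{(0)} = g_r`, `A^{(0)} = G_{r,r}`,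
`B^{(0)} = 0`, and, with `s = r - k - 1` and `δ = gcd₄(G_{s,s}, G_{r,s}^{(k)})`,
`A^{(k+1)} = G_{s,s} / δ`, `B^{(k+1)} = G_{r,s}^{(k)} / δ`, and
`g_r^{(k+1)} = A^{(k+1)} g_r^{(k)} - B^{(k+1)} g_s` in `R`, the polynomials `P k j` being
representatives of the entries of `g_r^{(k)}`. -/
structure IsElimination {N : ℕ} (m : Fin N → ℕ) (G : Fin N → Fin N → (ZMod 4)[X]) (r : Fin N)
    (P : ℕ → Fin N → (ZMod 4)[X]) (A B : ℕ → (ZMod 4)[X]) : Prop where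
  row_zero : P 0 = G r
  A_zero : A 0 = G r r
  B_zero : B 0 = 0
  quotients : ∀ k : ℕ, k < (r : ℕ) → ∃ δ : (ZMod 4)[X],
    IsGcdFour (G (pivot r k) (pivot r k)) (P k (pivot r k)) δ ∧
    A (k + 1) * δ = G (pivot r k) (pivot r k) ∧
    B (k + 1) * δ = P k (pivot r k)
  row_succ : ∀ k : ℕ, k < (r : ℕ) →
    ofPolys m (P (k + 1)) = A (k + 1) • ofPolys m (P k) - B (k + 1) • ofPolys m (G (pivot r k))

/-- The polynomial `G_{r,r}^{(r-1)} = A_{r,r}^{(0)} A_{r,r-1}^{(1)} ⋯ A_{r,1}^{(r-1)}`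
(rows are counted from 0 here). -/
def elimDiagonal {N : ℕ} (r : Fin N) (A : ℕ → (ZMod 4)[X]) : (ZMod 4)[X] :=
  ∏ k ∈ Finset.range ((r : ℕ) + 1), A k

end GQC

end

/-!
Two ideas carry the proof: the elimination computes a generator of a shortened code, and shortening
is dual to truncation.

*Duality.* `ℤ₄` is an injective module over itself, so a functional on `C` that depends only on the
blocks before `i` extends to all words (`exists_mem_dualCode_iff`). Hence the `i`-th blocks of the
dual codewords that vanish after block `i` form the dual of the cyclic code `K_i` of all `i`-th
blocks of codewords that vanish before block `i`. If `K_i = ⟨g⟩` with `g h = x^{m_i} - 1`, this dual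
is `⟨h^*⟩` (`cyclic_dual_iff`), and `E_{i,i}` generates it. As `m_i` is odd, a monic divisor of
`x^{m_i} - 1` is determined by its reduction modulo 2, so a generator in normal form is the monic
one up to sign (`IsCyclicNormalForm.eq_or_eq_neg`). Thus `E_{i,i} = ±h^*`, and
`g^* h^* = 1 - x^{m_i}` gives the claim.

*Elimination.* It remains to see that `K_i` is generated by `g = ∏ₖ A^{(k)}` and that
`g ∣ x^{m_i} - 1`. Both follow from one step, `IsElimination.exists_factor`: when the diagonal entry
`A δ` of the pivot row divides `x^{m_r} - 1` and the entry to be cleared is `B δ` with `A` and `B`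
coprime, a combination `q g⁽ᵏ⁾ + u` can vanish at the pivot only if `A ∣ q`, and then it is a
multiple of `g^{(k+1)}` up to rows above the pivot.

The diagonal entries of the generating sets of the truncated codes must therefore divide
`x^{m_r} - 1`. For the full code this is the hypothesis on `F`. It passes from the first `i + 1` to
the first `i` blocks since, when block `i` is deleted, the leading ideal of row `r` becomes `⟨δ⟩`,
with `δ` the greatest common divisor found at that pivot (`IsElimination.exists_mem_pivot_iff`,
`HasMonicLeading.step`).
-/

namespace GQC

/-! ### Polynomials over `ℤ₄` and normal forms -/

lemma two_dvd_of_red_eq_zero {p : (ZMod 4)[X]} (h : red p = 0) : 2 ∣ p := by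
  have h2 : ∀ a : ZMod 4, ZMod.castHom (by norm_num : 2 ∣ 4) (ZMod 2) a = 0 → a ∈ Ideal.span {(2 : ZMod 4)} := by
    intro a ha
    rw [Ideal.mem_span_singleton]
    revert a
    decide
  have h1 : p ∈ Ideal.map (C : ZMod 4 →+* _) (Ideal.span {(2 : ZMod 4)}) := by
    rw [Ideal.mem_map_C_iff]
    intro n
    apply h2
    rw [← coeff_map]
    change (red p).coeff n = 0
    rw [h, coeff_zero]
  rw [Ideal.map_span, Set.image_singleton, Ideal.mem_span_singleton] at h1
  exact h1

lemma four_eq_zero : (4 : (ZMod 4)[X]) = 0 := by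
  have : (4 : ZMod 4) = 0 := by decide
  rw [← map_ofNat (C : ZMod 4 →+* (ZMod 4)[X]) 4, this, C_0]

lemma red_mul (p q : (ZMod 4)[X]) : red (p * q) = red p * red q := Polynomial.map_mul _

lemma red_add (p q : (ZMod 4)[X]) : red (p + q) = red p + red q := Polynomial.map_add _

lemma red_surjective : Function.Surjective red :=
  Polynomial.map_surjective _ (ZMod.ringHom_surjective _)

lemma red_two_mul (p : (ZMod 4)[X]) : red (2 * p) = 0 := by
  have : red (2 : (ZMod 4)[X]) = 0 := by
    have h : (2 : (ZMod 2)[X]) = 0 := by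
      have : (2 : ZMod 2) = 0 := by decide
      rw [← map_ofNat (C : ZMod 2 →+* (ZMod 2)[X]) 2, this, C_0]
    rw [red, Polynomial.map_ofNat, h]
  rw [red_mul, this, zero_mul]

/-- Bézout identities lift along the reduction, since its kernel `⟨2⟩` squares to zero. -/
lemma isCoprime_of_red {a b : (ZMod 4)[X]} (h : IsCoprime (red a) (red b)) : IsCoprime a b := by
  obtain ⟨u, v, huv⟩ := h
  obtain ⟨u, rfl⟩ := red_surjective u
  obtain ⟨v, rfl⟩ := red_surjective v
  have h0 : red (u * a + v * b - 1) = 0 := by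
    rw [red, Polynomial.map_sub, Polynomial.map_one, ← red, red_add, red_mul, red_mul, huv, sub_self]
  obtain ⟨z, hz⟩ := two_dvd_of_red_eq_zero h0
  refine ⟨(1 + 2 * z) * u, (1 + 2 * z) * v, ?_⟩
  linear_combination (1 + 2 * z) * hz + (z + z ^ 2) * four_eq_zero

lemma monic_X_pow_sub_one {n : ℕ} (hn : Odd n) : (X ^ n - 1 : (ZMod 4)[X]).Monic :=
  monic_X_pow_sub_C 1 hn.pos.ne'

lemma separable_red_X_pow_sub_one {n : ℕ} (hn : Odd n) :
    (red (X ^ n - 1 : (ZMod 4)[X])).Separable := by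
  have : red (X ^ n - 1 : (ZMod 4)[X]) = X ^ n - 1 := by
    simp [red]
  rw [this, X_pow_sub_one_separable_iff, Ne, ZMod.natCast_eq_zero_iff]
  exact hn.not_two_dvd_nat

/-- Uniqueness in Hensel's lemma: monic divisors of `x^n - 1`, `n` odd, are determined by their
reductions. -/
lemma eq_of_red_eq {n : ℕ} (hn : Odd n) {f d : (ZMod 4)[X]} (hf : f.Monic) (hd : d.Monic)
    (hfn : f ∣ X ^ n - 1) (hdn : d ∣ X ^ n - 1) (h : red d = red f) : d = f := by
  obtain ⟨f', hf'⟩ := hfn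
  have hsep := separable_red_X_pow_sub_one hn
  rw [hf', red_mul] at hsep
  have hco : IsCoprime d f' := isCoprime_of_red (h ▸ hsep.isCoprime)
  have hdvd : d ∣ f := hco.dvd_of_dvd_mul_right (hf' ▸ hdn)
  refine (eq_of_monic_of_dvd_of_natDegree_le hd hf hdvd ?_).symm
  rw [← hf.natDegree_map (ZMod.castHom (by norm_num : 2 ∣ 4) (ZMod 2)),
    ← hd.natDegree_map (ZMod.castHom (by norm_num : 2 ∣ 4) (ZMod 2))]
  exact (congrArg natDegree h).ge

lemma natDegree_two_mul_le (g : (ZMod 4)[X]) : (2 * g).natDegree ≤ g.natDegree := by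
  rw [← map_ofNat (C : ZMod 4 →+* (ZMod 4)[X]) 2]
  exact natDegree_C_mul_le _ _

/-- If the cyclic code generated by a polynomial `p` in normal form is also generated by a monic
divisor `d` of `x^n - 1`, then `p` is `d` up to sign: the summand `2g` can only be `0` or `2d`. -/
lemma IsCyclicNormalForm.eq_or_eq_neg {n : ℕ} (hn : Odd n) {p d : (ZMod 4)[X]}
    (hp : IsCyclicNormalForm n p) (hd : d.Monic)
    (h : ∀ s, s ∈ Ideal.span {p, X ^ n - 1} ↔ d ∣ s) : p = d ∨ p = -d := by
  obtain ⟨f, g, rfl, hf, hfn, hg⟩ := hp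
  have hdp : d ∣ f + 2 * g := (h _).1 (Ideal.subset_span (by simp))
  have hdn : d ∣ X ^ n - 1 := (h _).1 (Ideal.subset_span (by simp))
  obtain ⟨a, b, hab⟩ := Ideal.mem_span_pair.1 ((h d).2 dvd_rfl)
  have hred : red (f + 2 * g) = red f := by rw [red_add, red_two_mul, add_zero]
  have h1 : red d ∣ red f := by
    rw [← hred]; exact Polynomial.map_dvd _ hdp
  have h2 : red f ∣ red d := by
    rw [← hab, red_add, red_mul, hred]
    exact dvd_add (dvd_mul_left _ _) (Polynomial.map_dvd _ (hfn.mul_left b))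
  have hdf : d = f := eq_of_red_eq hn hf hd hfn hdn
    (eq_of_monic_of_associated (hd.map _) (hf.map _) (associated_of_dvd_dvd h1 h2))
  subst hdf
  rcases hg with rfl | ⟨hgm, hgd⟩
  · left; ring
  right
  obtain ⟨w, hw⟩ : d ∣ 2 * g := (dvd_add_right dvd_rfl).1 hdp
  have hw0 : w ≠ 0 := by
    rintro rfl
    have h3 : (2 * g).coeff g.natDegree = 0 := by rw [hw]; simp
    rw [← map_ofNat (C : ZMod 4 →+* (ZMod 4)[X]) 2, coeff_C_mul, hgm.coeff_natDegree] at h3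
    exact absurd h3 (by decide)
  have hle : d.natDegree ≤ g.natDegree :=
    calc d.natDegree ≤ (d * w).natDegree := by rw [hd.natDegree_mul' hw0]; omega
      _ ≤ g.natDegree := hw ▸ natDegree_two_mul_le g
  rw [eq_of_monic_of_dvd_of_natDegree_le hgm hd hgd hle]
  linear_combination g * four_eq_zero

/-- A polynomial in normal form is monic up to sign. -/
lemma IsCyclicNormalForm.monic_or_monic_neg {n : ℕ} {p : (ZMod 4)[X]}
    (hp : IsCyclicNormalForm n p) : p.Monic ∨ (-p).Monic := by
  obtain ⟨f, g, rfl, hf, -, rfl | ⟨hgm, hgd⟩⟩ := hp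
  · left; simpa using hf
  rcases le_or_gt f.natDegree g.natDegree with hle | hlt
  · right
    rw [eq_of_monic_of_dvd_of_natDegree_le hgm hf hgd hle]
    convert hgm using 1
    linear_combination -g * four_eq_zero
  · left
    refine hf.add_of_left (degree_lt_degree ?_)
    exact (natDegree_two_mul_le g).trans_lt hlt

lemma IsGcdFour.monic {f g d : (ZMod 4)[X]} (h : IsGcdFour f g d) : d.Monic := by
  obtain ⟨r, h, e, t, hh, -, -, -, -, rfl⟩ := h
  exact monic_prod_of_monic _ _ fun j _ => (hh j).1.pow _

lemma IsGcdFour.isCoprime {f g d a b : (ZMod 4)[X]} (h : IsGcdFour f g d) (ha : a * d = f)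
    (hb : b * d = g) : IsCoprime a b := by
  have hd := h.monic
  obtain ⟨r, h, e, t, hh, hco, -, rfl, rfl, rfl⟩ := h
  have key : ∀ (c : (ZMod 4)[X]) (s : Fin r → ℕ), (∀ j, min (e j) (t j) ≤ s j) →
      c * ∏ j, h j ^ min (e j) (t j) = ∏ j, h j ^ s j →
      c = ∏ j, h j ^ (s j - min (e j) (t j)) := by
    intro c s hs hc
    apply hd.isRegular.right
    change c * _ = _ * _
    rw [hc, ← Finset.prod_mul_distrib]
    exact Finset.prod_congr rfl fun j _ => by rw [← pow_add, Nat.sub_add_cancel (hs j)]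
  rw [key a e (fun j => min_le_left _ _) ha, key b t (fun j => min_le_right _ _) hb]
  refine IsCoprime.prod_left fun j _ => IsCoprime.prod_right fun k _ => ?_
  by_cases hjk : j = k
  · subst hjk
    rcases le_total (e j) (t j) with h1 | h1
    · rw [min_eq_left h1, Nat.sub_self, pow_zero]; exact isCoprime_one_left
    · rw [min_eq_right h1, Nat.sub_self, pow_zero]; exact isCoprime_one_right
  · exact (hco j k hjk).pow

/-! ### Row spans of triangular generating sets -/

section Rows

variable {N : ℕ} {m : Fin N → ℕ} {G : Fin N → Fin N → (ZMod 4)[X]}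

lemma mk_eq_mk_iff {n : ℕ} {a b : (ZMod 4)[X]} :
    (Ideal.Quotient.mk _ a : Block n) = Ideal.Quotient.mk _ b ↔ X ^ n - 1 ∣ a - b := by
  rw [Ideal.Quotient.eq, Ideal.mem_span_singleton]

lemma mk_eq_zero_iff {n : ℕ} {a : (ZMod 4)[X]} :
    (Ideal.Quotient.mk _ a : Block n) = 0 ↔ X ^ n - 1 ∣ a := by
  rw [Ideal.Quotient.eq_zero_iff_dvd]

lemma smul_ofPolys_apply (p : (ZMod 4)[X]) (a : Fin N → (ZMod 4)[X]) (j : Fin N) :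
    (p • ofPolys m a) j = Ideal.Quotient.mk _ (p * a j) := rfl

/-- The `ℤ₄[x]`-submodule of `R` generated by the first `t` rows of `G`. -/
noncomputable def rowSpan (m : Fin N → ℕ) (G : Fin N → Fin N → (ZMod 4)[X]) (t : ℕ) :
    Submodule (ZMod 4)[X] (Ambient m) :=
  Submodule.span _ ((fun s => ofPolys m (G s)) '' {s | (s : ℕ) < t})

lemma row_mem_rowSpan {s : Fin N} {t : ℕ} (h : (s : ℕ) < t) :
    ofPolys m (G s) ∈ rowSpan m G t :=
  Submodule.subset_span ⟨s, h, rfl⟩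

lemma rowSpan_mono {s t : ℕ} (h : s ≤ t) : rowSpan m G s ≤ rowSpan m G t :=
  Submodule.span_mono (Set.image_mono fun _ hr => lt_of_lt_of_le hr h)

/-- The rows of `G` are lower triangular, and the diagonal entry of row `r` divides `x^{m_r} - 1`
and generates the `r`-th components of the combinations of rows that vanish after block `r`. -/
structure IsReduced (m : Fin N → ℕ) (G : Fin N → Fin N → (ZMod 4)[X]) : Prop where
  lower : ∀ r j, r < j → G r j = 0
  dvd : ∀ r, G r r ∣ X ^ m r - 1
  leading : ∀ r, ∀ v ∈ rowSpan m G N, (∀ j, r < j → v j = 0) →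
    ∃ p, v r = Ideal.Quotient.mk _ (p * G r r)

lemma IsReduced.row_apply_eq_zero (h : IsReduced m G) {r j : Fin N} (hrj : r < j) :
    ofPolys m (G r) j = 0 := by
  simp [ofPolys, h.lower r j hrj]

lemma IsReduced.apply_eq_zero_of_mem (h : IsReduced m G) {t : ℕ} {v : Ambient m}
    (hv : v ∈ rowSpan m G t) {j : Fin N} (hj : t ≤ j) : v j = 0 := by
  refine Submodule.span_induction (p := fun v _ => v j = 0) ?_ rfl ?_ ?_ hv
  · rintro _ ⟨s, hs, rfl⟩
    exact h.row_apply_eq_zero (Fin.lt_def.2 (lt_of_lt_of_le hs hj))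
  · intro x y _ _ hx hy
    rw [Pi.add_apply, hx, hy, add_zero]
  · intro a x _ hx
    rw [Pi.smul_apply, hx, smul_zero]

lemma IsReduced.mem_rowSpan (h : IsReduced m G) (t : ℕ) : ∀ v ∈ rowSpan m G N,
    (∀ j : Fin N, t ≤ j → v j = 0) → v ∈ rowSpan m G t := by
  induction t with
  | zero =>
    intro v _ hv
    have : v = 0 := funext fun j => hv j (Nat.zero_le _)
    rw [this]
    exact zero_mem _
  | succ t ih =>
    intro v hvM hv
    by_cases ht : t < N
    · obtain ⟨p, hp⟩ := h.leading ⟨t, ht⟩ v hvM fun j hj => hv j hj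
      have hg : ofPolys m (G ⟨t, ht⟩) ∈ rowSpan m G (t + 1) := row_mem_rowSpan (Nat.lt_succ_self t)
      have hu : v - p • ofPolys m (G ⟨t, ht⟩) ∈ rowSpan m G t := by
        refine ih _ (sub_mem hvM (Submodule.smul_mem _ _ (row_mem_rowSpan ht))) fun j hj => ?_
        rcases hj.eq_or_lt with hj | hj
        · obtain rfl : j = ⟨t, ht⟩ := Fin.ext hj.symm
          rw [Pi.sub_apply, hp, smul_ofPolys_apply, sub_self]
        · rw [Pi.sub_apply, hv j hj, Pi.smul_apply, h.row_apply_eq_zero (Fin.lt_def.2 hj),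
            smul_zero, sub_zero]
      rw [← sub_add_cancel v (p • ofPolys m (G ⟨t, ht⟩))]
      exact add_mem (rowSpan_mono (Nat.le_succ t) hu) (Submodule.smul_mem _ _ hg)
    · exact rowSpan_mono (Nat.le_succ t) (ih v hvM fun j hj => absurd j.isLt (by omega))

/-- An element of the span of the first `t + 1` rows has last possibly nonzero component divisible
by the corresponding diagonal entry. -/
lemma IsReduced.leading_of_mem (h : IsReduced m G) {r : Fin N} {v : Ambient m}
    (hv : v ∈ rowSpan m G (r + 1)) : ∃ p, v r = Ideal.Quotient.mk _ (p * G r r) :=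
  h.leading r v (rowSpan_mono r.isLt hv) fun _ hj => h.apply_eq_zero_of_mem hv hj

end Rows

/-! ### The elimination -/

section Elimination

variable {n : ℕ} {m : Fin (n + 1) → ℕ} {G : Fin (n + 1) → Fin (n + 1) → (ZMod 4)[X]}
  {P : ℕ → Fin (n + 1) → (ZMod 4)[X]} {A B : ℕ → (ZMod 4)[X]}

lemma pivot_last_val {k : ℕ} : (pivot (Fin.last n) k : ℕ) = n - k - 1 := rfl

/-- The step from `k` to `k + 1` with the data of the greatest common divisor unpacked. -/
lemma IsElimination.exists_coprime (he : IsElimination m G (Fin.last n) P A B) {k : ℕ}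
    (hk : k < n) : ∃ δ : (ZMod 4)[X], δ.Monic ∧ IsCoprime (A (k + 1)) (B (k + 1)) ∧
      A (k + 1) * δ = G (pivot (Fin.last n) k) (pivot (Fin.last n) k) ∧
      B (k + 1) * δ = P k (pivot (Fin.last n) k) := by
  obtain ⟨δ, h1, h2, h3⟩ := he.quotients k hk
  exact ⟨δ, h1.monic, h1.isCoprime h2 h3, h2, h3⟩

lemma IsElimination.mem (he : IsElimination m G (Fin.last n) P A B) {k : ℕ} (hk : k ≤ n) :
    ofPolys m (P k) ∈ rowSpan m G (n + 1) := by
  induction k with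
  | zero =>
    rw [he.row_zero]
    exact row_mem_rowSpan (Nat.lt_succ_self n)
  | succ k ih =>
    rw [he.row_succ k hk]
    exact sub_mem (Submodule.smul_mem _ _ (ih (by omega)))
      (Submodule.smul_mem _ _ (row_mem_rowSpan (Fin.isLt _)))

lemma IsElimination.apply_eq_zero (he : IsElimination m G (Fin.last n) P A B)
    (hG : IsReduced m G) {k : ℕ} (hk : k ≤ n) (j : Fin (n + 1)) (hj : n - k ≤ j) (hjn : (j : ℕ) < n) :
    ofPolys m (P k) j = 0 := by
  induction k with
  | zero => omega
  | succ k ih =>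
    rw [he.row_succ k hk, Pi.sub_apply]
    rcases hj.eq_or_lt with hj | hj
    · obtain rfl : j = pivot (Fin.last n) k := Fin.ext (by rw [pivot_last_val]; omega)
      obtain ⟨δ, -, -, h2, h3⟩ := he.exists_coprime hk
      rw [smul_ofPolys_apply, smul_ofPolys_apply, ← h2, ← h3, sub_eq_zero]
      congr 1
      ring
    · rw [Pi.smul_apply, ih (by omega) (by omega), Pi.smul_apply,
        hG.row_apply_eq_zero (Fin.lt_def.2 (by rw [pivot_last_val]; omega)), smul_zero, smul_zero,
        sub_zero]

lemma IsElimination.apply_last (he : IsElimination m G (Fin.last n) P A B)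
    (hG : IsReduced m G) {k : ℕ} (hk : k ≤ n) :
    ofPolys m (P k) (Fin.last n) = Ideal.Quotient.mk _ (∏ j ∈ Finset.range (k + 1), A j) := by
  induction k with
  | zero => simp [he.row_zero, he.A_zero, ofPolys]
  | succ k ih =>
    rw [he.row_succ k hk, Pi.sub_apply, Pi.smul_apply, ih (by omega), Pi.smul_apply,
      hG.row_apply_eq_zero (Fin.lt_def.2 (by rw [pivot_last_val, Fin.val_last]; omega)), smul_zero,
      sub_zero, Finset.prod_range_succ _ (k + 1), mul_comm]
    rfl

/-- If `u` lies in the span of the first `n - k` rows and `q g⁽ᵏ⁾ + u` vanishes at the pivot, then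
`A^{(k+1)}` divides `q`, and `q g⁽ᵏ⁾ + u` is a multiple of `g^{(k+1)}` up to the span of the first
`n - k - 1` rows. -/
lemma IsElimination.exists_factor (he : IsElimination m G (Fin.last n) P A B)
    (hG : IsReduced m G) {k : ℕ} (hk : k < n) {q : (ZMod 4)[X]}
    {u : Ambient m} (hu : u ∈ rowSpan m G (n - k))
    (h0 : (q • ofPolys m (P k) + u) (pivot (Fin.last n) k) = 0) :
    ∃ q', q = q' * A (k + 1) ∧
      q • ofPolys m (P k) + u - q' • ofPolys m (P (k + 1)) ∈ rowSpan m G (n - (k + 1)) := by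
  obtain ⟨δ, hδ, hco, h2, h3⟩ := he.exists_coprime hk
  have hs1 : (pivot (Fin.last n) k : ℕ) + 1 = n - k := by rw [pivot_last_val]; omega
  have hrow := he.row_succ k hk
  set s := pivot (Fin.last n) k
  obtain ⟨p, hp⟩ := hG.leading_of_mem (r := s) (v := u) (by rwa [hs1])
  obtain ⟨D, hD⟩ := hG.dvd s
  rw [Pi.add_apply, hp, smul_ofPolys_apply, ← map_add, mk_eq_zero_iff] at h0
  obtain ⟨z, hz⟩ := h0
  -- The relation at the pivot, with the common factor `δ` cancelled.
  have hz' : q * B (k + 1) + p * A (k + 1) = A (k + 1) * D * z := by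
    apply hδ.isRegular.right
    change (q * B (k + 1) + p * A (k + 1)) * δ = A (k + 1) * D * z * δ
    rw [hD, ← h2, ← h3] at hz
    linear_combination hz
  have hA : A (k + 1) ∣ q := by
    refine hco.dvd_of_dvd_mul_right ⟨D * z - p, ?_⟩
    linear_combination hz'
  obtain ⟨q', rfl⟩ := hA
  refine ⟨q', mul_comm _ _, ?_⟩
  have heq : (A (k + 1) * q') • ofPolys m (P k) + u - q' • ofPolys m (P (k + 1)) =
      u + (q' * B (k + 1)) • ofPolys m (G s) := by
    rw [hrow, smul_sub, smul_smul, smul_smul, mul_comm q']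
    abel
  rw [heq]
  refine hG.mem_rowSpan _ _ (add_mem (rowSpan_mono (by omega) hu)
    (Submodule.smul_mem _ _ (row_mem_rowSpan s.isLt))) fun j hj => ?_
  have hsv : (s : ℕ) = n - (k + 1) := pivot_last_val
  rcases hj.eq_or_lt with hj | hj
  · obtain rfl : j = s := Fin.ext (by omega)
    rw [Pi.add_apply, hp, smul_ofPolys_apply, ← map_add, mk_eq_zero_iff]
    refine ⟨z, ?_⟩
    rw [hD, ← h2]
    linear_combination δ * hz'
  · rw [Pi.add_apply, hG.apply_eq_zero_of_mem hu (by omega), Pi.smul_apply,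
      hG.row_apply_eq_zero (Fin.lt_def.2 (by omega)), smul_zero, add_zero]

/-- Codewords that vanish in the blocks already cleared are multiples of `g⁽ᵏ⁾` up to the rows
not yet used. -/
lemma IsElimination.exists_sub_mem (he : IsElimination m G (Fin.last n) P A B)
    (hG : IsReduced m G) {v : Ambient m} (hv : v ∈ rowSpan m G (n + 1))
    {k : ℕ} (hk : k ≤ n)
    (h0 : ∀ j : Fin (n + 1), n - k ≤ j → (j : ℕ) < n → v j = 0) :
    ∃ q : (ZMod 4)[X], v - q • ofPolys m (P k) ∈ rowSpan m G (n - k) := by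
  induction k with
  | zero =>
    obtain ⟨p, hp⟩ := hG.leading_of_mem (r := Fin.last n) hv
    refine ⟨p, hG.mem_rowSpan _ _ (sub_mem hv (Submodule.smul_mem _ _ (he.mem hk))) fun j hj => ?_⟩
    obtain rfl : j = Fin.last n := Fin.ext (by rw [Fin.val_last]; omega)
    rw [Pi.sub_apply, hp, he.row_zero, smul_ofPolys_apply, sub_self]
  | succ k ih =>
    obtain ⟨q, hq⟩ := ih (by omega) fun j hj hjn => h0 j (by omega) hjn
    have hv' : q • ofPolys m (P k) + (v - q • ofPolys m (P k)) = v := by abel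
    obtain ⟨q', -, hq'⟩ := he.exists_factor hG hk hq (by
      rw [hv']
      exact h0 _ (by rw [pivot_last_val]; omega) (by rw [pivot_last_val]; omega))
    exact ⟨q', hv' ▸ hq'⟩

/-- `Q = (x^{m_n} - 1) / ∏_{j ≤ k} A^{(j)}` exists because `Q g⁽ᵏ⁾` vanishes in the last block:
it is then a combination of the rows above, which forces the next `A^{(k+1)}` to divide `Q`. -/
lemma IsElimination.exists_mul_prod_eq (he : IsElimination m G (Fin.last n) P A B)
    (hG : IsReduced m G) {k : ℕ} (hk : k ≤ n) :
    ∃ Q : (ZMod 4)[X], Q * ∏ j ∈ Finset.range (k + 1), A j = X ^ m (Fin.last n) - 1 ∧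
      Q • ofPolys m (P k) ∈ rowSpan m G (n - k) := by
  induction k with
  | zero =>
    obtain ⟨Q, hQ⟩ := hG.dvd (Fin.last n)
    refine ⟨Q, by rw [hQ, Finset.prod_range_one, he.A_zero, mul_comm], ?_⟩
    refine hG.mem_rowSpan _ _ (Submodule.smul_mem _ _ (he.mem hk)) fun j hj => ?_
    obtain rfl : j = Fin.last n := Fin.ext (by rw [Fin.val_last]; omega)
    rw [he.row_zero, smul_ofPolys_apply, mk_eq_zero_iff, hQ, mul_comm]
  | succ k ih =>
    obtain ⟨Q, hQ, hmem⟩ := ih (by omega)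
    have h0 : Q • ofPolys m (P k) + -(Q • ofPolys m (P k)) = 0 := add_neg_cancel _
    obtain ⟨Q', rfl, hQ'⟩ := he.exists_factor hG hk (neg_mem hmem) (by rw [h0]; rfl)
    refine ⟨Q', ?_, ?_⟩
    · rw [Finset.prod_range_succ, ← hQ]
      ring
    · rwa [h0, zero_sub, neg_mem_iff] at hQ'

lemma IsElimination.elimDiagonal_dvd (he : IsElimination m G (Fin.last n) P A B)
    (hG : IsReduced m G) :
    elimDiagonal (Fin.last n) A ∣ X ^ m (Fin.last n) - 1 := by
  obtain ⟨Q, hQ, -⟩ := he.exists_mul_prod_eq hG le_rfl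
  exact ⟨Q, by rw [← hQ, mul_comm]; rfl⟩

/-- The last blocks of the codewords that vanish in all other blocks form the cyclic code generated
by `elimDiagonal`. -/
lemma IsElimination.exists_mem_last_iff (he : IsElimination m G (Fin.last n) P A B)
    (hG : IsReduced m G) (p : (ZMod 4)[X]) :
    (∃ v ∈ rowSpan m G (n + 1), (∀ j : Fin (n + 1), (j : ℕ) < n → v j = 0) ∧
      v (Fin.last n) = Ideal.Quotient.mk _ p) ↔ elimDiagonal (Fin.last n) A ∣ p := by
  constructor
  · rintro ⟨v, hv, h0, hp⟩
    obtain ⟨q, hq⟩ := he.exists_sub_mem hG hv le_rfl fun j _ hj => h0 j hj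
    have h1 := hG.apply_eq_zero_of_mem hq (j := Fin.last n) (by simp)
    rw [Pi.sub_apply, hp, Pi.smul_apply, he.apply_last hG le_rfl, sub_eq_zero] at h1
    have h2 := mk_eq_mk_iff.1 (h1 : _ = Ideal.Quotient.mk _ (q * elimDiagonal (Fin.last n) A))
    exact (dvd_iff_dvd_of_dvd_sub ((he.elimDiagonal_dvd hG).trans h2)).2 (dvd_mul_left _ _)
  · rintro ⟨q, rfl⟩
    refine ⟨q • ofPolys m (P n), Submodule.smul_mem _ _ (he.mem le_rfl), fun j hj => ?_, ?_⟩
    · rw [Pi.smul_apply, he.apply_eq_zero hG le_rfl j (by omega) hj, smul_zero]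
    · rw [Pi.smul_apply, he.apply_last hG le_rfl, mul_comm]
      rfl

/-- After deletion of the last block, the row of the pivot still has a monic divisor of
`x^{m_r} - 1` as its leading ideal, namely the greatest common divisor computed at that pivot. -/
lemma IsElimination.exists_mem_pivot_iff (he : IsElimination m G (Fin.last n) P A B)
    (hG : IsReduced m G) {r : Fin (n + 1)} (hr : (r : ℕ) < n) :
    ∃ δ : (ZMod 4)[X], δ.Monic ∧ ∀ p, (∃ v ∈ rowSpan m G (n + 1),
      (∀ j : Fin (n + 1), r < j → (j : ℕ) < n → v j = 0) ∧ v r = Ideal.Quotient.mk _ p) ↔ δ ∣ p := by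
  obtain ⟨k, hk, hs⟩ : ∃ k < n, r = pivot (Fin.last n) k :=
    ⟨n - r - 1, by omega, Fin.ext (by rw [pivot_last_val]; omega)⟩
  have hrk : (r : ℕ) + 1 = n - k := by rw [hs, pivot_last_val]; omega
  obtain ⟨δ, hδ, hco, h2, h3⟩ := he.exists_coprime hk
  rw [← hs] at h2 h3
  refine ⟨δ, hδ, fun p => ⟨?_, ?_⟩⟩
  · rintro ⟨v, hv, h0, hp⟩
    obtain ⟨q, hq⟩ := he.exists_sub_mem hG hv hk.le fun j hj hjn =>
      h0 j (Fin.lt_def.2 (by omega)) hjn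
    obtain ⟨a, ha⟩ := hG.leading_of_mem (r := r) (by rwa [hrk])
    rw [Pi.sub_apply, hp, smul_ofPolys_apply, ← map_sub, mk_eq_mk_iff] at ha
    have hdvd : δ ∣ X ^ m r - 1 := (Dvd.intro_left _ h2).trans (hG.dvd r)
    obtain ⟨z, hz⟩ := hdvd.trans ha
    refine ⟨z + q * B (k + 1) + a * A (k + 1), ?_⟩
    rw [← h2, ← h3] at hz
    linear_combination hz
  · rintro ⟨q, rfl⟩
    obtain ⟨a, b, hab⟩ := hco
    refine ⟨(q * b) • ofPolys m (P k) + (q * a) • ofPolys m (G r),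
      add_mem (Submodule.smul_mem _ _ (he.mem hk.le))
        (Submodule.smul_mem _ _ (row_mem_rowSpan r.isLt)), fun j hj hjn => ?_, ?_⟩
    · rw [Pi.add_apply, Pi.smul_apply, he.apply_eq_zero hG hk.le j
        (by have := Fin.lt_def.1 hj; omega) hjn, Pi.smul_apply, hG.row_apply_eq_zero hj, smul_zero,
        smul_zero, add_zero]
    · rw [Pi.add_apply, smul_ofPolys_apply, smul_ofPolys_apply, ← map_add, ← h2, ← h3]
      congr 1
      linear_combination q * δ * hab

end Elimination

/-! ### Words and polynomials -/

instance nontrivial_zmod_four : Nontrivial (ZMod 4) := ⟨0, 1, by decide⟩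

/-- The polynomial `∑ⱼ cⱼ xʲ` of a single block. -/
noncomputable def blockPoly {n : ℕ} (c : Fin n → ZMod 4) : (ZMod 4)[X] :=
  ∑ j : Fin n, C (c j) * X ^ (j : ℕ)

lemma toAmbient_apply {l : ℕ} {m : Fin l → ℕ} (c : Word m) (i : Fin l) :
    toAmbient c i = Ideal.Quotient.mk _ (blockPoly (c i)) := rfl

lemma coeff_blockPoly {n : ℕ} (c : Fin n → ZMod 4) (j : Fin n) : (blockPoly c).coeff j = c j := by
  rw [blockPoly, finsetSum_coeff, Finset.sum_eq_single j]
  · simp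
  · intro k _ hk
    rw [coeff_C_mul_X_pow, if_neg fun h => hk (Fin.ext h.symm)]
  · simp

lemma blockPoly_injective {n : ℕ} : Function.Injective (blockPoly (n := n)) := fun c d h =>
  funext fun j => by rw [← coeff_blockPoly c, h, coeff_blockPoly]

lemma degree_blockPoly_lt {n : ℕ} (c : Fin n → ZMod 4) : (blockPoly c).degree < n := by
  refine (degree_lt_iff_coeff_zero _ _).2 fun k hk => ?_
  rw [blockPoly, finsetSum_coeff]
  refine Finset.sum_eq_zero fun j _ => ?_
  rw [coeff_C_mul_X_pow, if_neg (by omega)]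

lemma degree_X_pow_sub_one {n : ℕ} (hn : Odd n) : (X ^ n - 1 : (ZMod 4)[X]).degree = n :=
  degree_X_pow_sub_C hn.pos 1

lemma mk_blockPoly_injective {n : ℕ} (hn : Odd n) {c d : Fin n → ZMod 4}
    (h : (Ideal.Quotient.mk _ (blockPoly c) : Block n) = Ideal.Quotient.mk _ (blockPoly d)) :
    c = d := by
  have hq := monic_X_pow_sub_one hn
  have h1 := modByMonic_eq_of_dvd_sub hq (mk_eq_mk_iff.1 h)
  rw [(modByMonic_eq_self_iff hq).2 (by rw [degree_X_pow_sub_one hn]; exact degree_blockPoly_lt c),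
    (modByMonic_eq_self_iff hq).2 (by rw [degree_X_pow_sub_one hn]; exact degree_blockPoly_lt d)]
    at h1
  exact blockPoly_injective h1

lemma exists_blockPoly {n : ℕ} (hn : Odd n) (p : (ZMod 4)[X]) :
    ∃ c : Fin n → ZMod 4, blockPoly c = p %ₘ (X ^ n - 1) := by
  have hq := monic_X_pow_sub_one hn
  refine ⟨fun j => (p %ₘ (X ^ n - 1)).coeff j, ?_⟩
  have hdeg : (p %ₘ (X ^ n - 1)).natDegree < n := by
    have h1 : (X ^ n - 1 : (ZMod 4)[X]).natDegree = n := natDegree_X_pow_sub_C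
    conv_rhs => rw [← h1]
    refine natDegree_modByMonic_lt _ hq fun h => hn.pos.ne' ?_
    rw [← h1, h, natDegree_one]
  conv_rhs => rw [as_sum_range_C_mul_X_pow' _ hdeg, Finset.sum_range]
  rfl

lemma exists_mk_blockPoly {n : ℕ} (hn : Odd n) (p : (ZMod 4)[X]) :
    ∃ c : Fin n → ZMod 4,
      (Ideal.Quotient.mk _ (blockPoly c) : Block n) = Ideal.Quotient.mk _ p := by
  obtain ⟨c, hc⟩ := exists_blockPoly hn p
  refine ⟨c, mk_eq_mk_iff.2 ?_⟩
  rw [hc, ← dvd_neg, neg_sub]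
  exact ⟨p /ₘ (X ^ n - 1), by rw [modByMonic_eq_sub_mul_div _ (X ^ n - 1)]; ring⟩

lemma toAmbient_surjective {l : ℕ} {m : Fin l → ℕ} (hm : ∀ i, Odd (m i)) :
    Function.Surjective (toAmbient (m := m)) := fun v => by
  have h : ∀ i, ∃ c : Fin (m i) → ZMod 4, (Ideal.Quotient.mk _ (blockPoly c) : Block (m i)) = v i :=
    fun i => by
      obtain ⟨p, hp⟩ := Ideal.Quotient.mk_surjective (v i)
      rw [← hp]
      exact exists_mk_blockPoly (hm i) p
  choose c hc using h
  exact ⟨c, funext hc⟩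

lemma toAmbient_apply_eq_zero_iff {l : ℕ} {m : Fin l → ℕ} {i : Fin l} (hm : Odd (m i))
    (c : Word m) : toAmbient c i = 0 ↔ c i = 0 := by
  have h0 : blockPoly (0 : Fin (m i) → ZMod 4) = 0 := by simp [blockPoly]
  constructor
  · intro h
    refine mk_blockPoly_injective hm ?_
    rw [h0, map_zero]
    exact h
  · intro h
    rw [toAmbient_apply, h, h0, map_zero]

/-! ### Reciprocal polynomials -/

lemma reverse_mul_reverse {n : ℕ} {g h : (ZMod 4)[X]} (hg : g.Monic) (hh : h.Monic)
    (hgh : g * h = X ^ n - 1) : g.reverse * h.reverse = 1 - X ^ n := by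
  rw [← reverse_mul (by rw [hg.leadingCoeff, hh.leadingCoeff]; decide), hgh, sub_eq_add_neg,
    ← C_1, ← C_neg, reverse_add_C]
  have hX : (X ^ n : (ZMod 4)[X]).reverse = 1 := by
    rw [← one_mul (X ^ n), reverse_mul_X_pow, ← C_1, reverse_C]
  rw [hX, natDegree_X_pow, C_neg, C_1]
  ring

lemma monic_reverse_or_monic_neg_reverse {n : ℕ} (hn : Odd n) {g h : (ZMod 4)[X]}
    (hgh : g * h = X ^ n - 1) : h.reverse.Monic ∨ (-h.reverse).Monic := by
  have h0 : g.coeff 0 * h.coeff 0 = -1 := by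
    rw [← mul_coeff_zero, hgh]
    simp [coeff_X_pow, hn.pos.ne]
  have h1 : ∀ a b : ZMod 4, a * b = -1 → b ≠ 0 ∧ (b = 1 ∨ -b = 1) := by decide
  obtain ⟨h2, h3⟩ := h1 _ _ h0
  have h4 : h.reverse.leadingCoeff = h.coeff 0 := by
    rw [reverse_leadingCoeff, trailingCoeff, natTrailingDegree_eq_zero.2 (Or.inr h2)]
  rw [← h4] at h3
  exact h3.imp id fun h => by rw [Monic, leadingCoeff_neg, h]

/-- In `ℤ₄[x]/⟨x^n - 1⟩` the reciprocal polynomial is, up to a power of the unit `x`, the image of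
the substitution `x ↦ x⁻¹ = x^{n-1}`. -/
lemma mk_comp_eq_reverse {n : ℕ} (hn : Odd n) (f : (ZMod 4)[X]) :
    (Ideal.Quotient.mk _ (f.comp (X ^ (n - 1))) : Block n) =
      Ideal.Quotient.mk _ (f.reverse * X ^ ((n - 1) * f.natDegree)) := by
  have hX : (Ideal.Quotient.mk _ X : Block n) * Ideal.Quotient.mk _ (X ^ (n - 1)) = 1 := by
    rw [← map_mul, ← pow_succ', Nat.sub_add_cancel hn.pos, ← map_one (Ideal.Quotient.mk _)]
    exact mk_eq_mk_iff.2 dvd_rfl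
  let _ : Invertible (Ideal.Quotient.mk _ (X ^ (n - 1)) : Block n) :=
    ⟨Ideal.Quotient.mk _ X, hX, by rw [mul_comm]; exact hX⟩
  have h := eval₂_reverse_mul_pow ((Ideal.Quotient.mk _).comp C)
    (Ideal.Quotient.mk _ (X ^ (n - 1)) : Block n) f
  rw [← hom_eval₂, ← comp] at h
  rw [← h, map_mul, pow_mul,
    map_pow (Ideal.Quotient.mk (Ideal.span {(X ^ n - 1 : (ZMod 4)[X])})) (X ^ (n - 1)) f.natDegree]
  congr 1
  change eval₂ ((Ideal.Quotient.mk (Ideal.span {(X ^ n - 1 : (ZMod 4)[X])})).comp C)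
    (Ideal.Quotient.mk _ X) f.reverse = _
  rw [← hom_eval₂, eval₂_C_X]

/-! ### Duality of cyclic codes -/

/-- The constant coefficient of the representative of degree less than `n` modulo `x^n - 1`. -/
noncomputable def constTerm (n : ℕ) : (ZMod 4)[X] →ₗ[ZMod 4] ZMod 4 :=
  lcoeff (ZMod 4) 0 ∘ₗ modByMonicHom (X ^ n - 1)

lemma constTerm_eq_of_dvd {n : ℕ} (hn : Odd n) {p q : (ZMod 4)[X]} (h : X ^ n - 1 ∣ p - q) :
    constTerm n p = constTerm n q :=
  congrArg (fun r => coeff r 0) (modByMonic_eq_of_dvd_sub (monic_X_pow_sub_one hn) h)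

lemma constTerm_X_pow {n : ℕ} (hn : Odd n) (k : ℕ) :
    constTerm n (X ^ k) = if n ∣ k then 1 else 0 := by
  have h1 : constTerm n (X ^ k) = constTerm n (X ^ (k % n)) := by
    refine constTerm_eq_of_dvd hn ?_
    conv_rhs => rw [← Nat.mod_add_div k n, pow_add, Nat.mod_add_div]
    rw [← mul_sub_one, pow_mul]
    exact (sub_one_dvd_pow_sub_one _ _).mul_left _
  have h2 : X ^ (k % n) %ₘ (X ^ n - 1) = (X ^ (k % n) : (ZMod 4)[X]) := by
    rw [modByMonic_eq_self_iff (monic_X_pow_sub_one hn), degree_X_pow_sub_one hn]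
    exact (degree_X_pow_le _).trans_lt (by exact_mod_cast Nat.mod_lt _ hn.pos)
  rw [h1]
  change (X ^ (k % n) %ₘ (X ^ n - 1)).coeff 0 = _
  rw [h2, coeff_X_pow]
  simp only [Nat.dvd_iff_mod_eq_zero, eq_comm]

/-- The inner product of two words `y` and `c` is the constant term of `y(x) c(x⁻¹)`. -/
lemma constTerm_mul_comp {n : ℕ} (hn : Odd n) (y c : Fin n → ZMod 4) :
    constTerm n (blockPoly y * (blockPoly c).comp (X ^ (n - 1))) = ∑ j, y j * c j := by
  have hjk : ∀ j k : Fin n, n ∣ j + (n - 1) * k ↔ k = j := by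
    intro j k
    have e : (j : ℕ) + (n - 1) * k + k = j + n * k := by
      obtain ⟨a, rfl⟩ : ∃ a, n = a + 1 := ⟨n - 1, (Nat.sub_add_cancel hn.pos).symm⟩
      rw [Nat.add_sub_cancel]; ring
    constructor
    · rintro ⟨t, ht⟩
      have e2 := congrArg (· % n) e
      simp only [ht, Nat.mul_add_mod, Nat.add_mul_mod_self_left, Nat.mod_eq_of_lt j.isLt,
        Nat.mod_eq_of_lt k.isLt] at e2
      exact Fin.ext e2
    · rintro rfl
      exact ⟨k, by omega⟩
  rw [blockPoly, blockPoly, sum_comp, Finset.sum_mul_sum, map_sum]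
  refine Finset.sum_congr rfl fun j _ => ?_
  rw [map_sum, Finset.sum_eq_single j]
  · have : C (y j) * X ^ (j : ℕ) * (C (c j) * X ^ (j : ℕ)).comp (X ^ (n - 1)) =
        (y j * c j) • X ^ (j + (n - 1) * j : ℕ) := by
      rw [mul_comp, C_comp, X_pow_comp, ← pow_mul, pow_add, smul_eq_C_mul, C_mul]; ring
    rw [this, map_smul, constTerm_X_pow hn, if_pos ((hjk j j).2 rfl), smul_eq_mul, mul_one]
  · intro k _ hk
    have : C (y j) * X ^ (j : ℕ) * (C (c k) * X ^ (k : ℕ)).comp (X ^ (n - 1)) =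
        (y j * c k) • X ^ (j + (n - 1) * k : ℕ) := by
      rw [mul_comp, C_comp, X_pow_comp, ← pow_mul, pow_add, smul_eq_C_mul, C_mul]; ring
    rw [this, map_smul, constTerm_X_pow hn, if_neg (fun h => hk ((hjk j k).1 h)), smul_zero]
  · simp

lemma dvd_of_constTerm_eq_zero {n : ℕ} (hn : Odd n) {p : (ZMod 4)[X]}
    (h : ∀ k, constTerm n (p * (X ^ k).comp (X ^ (n - 1))) = 0) : X ^ n - 1 ∣ p := by
  obtain ⟨c, hc⟩ := exists_mk_blockPoly hn p
  have hc0 : c = 0 := by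
    funext j
    have h1 : blockPoly (Pi.single j 1 : Fin n → ZMod 4) = X ^ (j : ℕ) := by
      rw [blockPoly, Finset.sum_eq_single j]
      · simp
      · intro k _ hk
        simp [hk]
      · simp
    have h2 := constTerm_mul_comp hn c (Pi.single j 1)
    rw [h1, constTerm_eq_of_dvd hn (q := p * (X ^ (j : ℕ)).comp (X ^ (n - 1))), h] at h2
    · simpa [Pi.single_apply] using h2.symm
    · rw [← sub_mul]
      exact (mk_eq_mk_iff.1 hc).mul_right _
  have h0 : blockPoly (0 : Fin n → ZMod 4) = 0 := by simp [blockPoly]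
  rw [← mk_eq_zero_iff, ← hc, hc0, h0, map_zero]

/-- The dual of the cyclic code `⟨g⟩`, where `g h = x^n - 1`, is `⟨h^*⟩`. -/
lemma cyclic_dual_iff {n : ℕ} (hn : Odd n) {g h : (ZMod 4)[X]} (hg : g.Monic) (hh : h.Monic)
    (hgh : g * h = X ^ n - 1) (y : Fin n → ZMod 4) :
    (∀ c : Fin n → ZMod 4, g ∣ blockPoly c → ∑ j, y j * c j = 0) ↔ h.reverse ∣ blockPoly y := by
  have hrev := reverse_mul_reverse hg hh hgh
  constructor
  · intro H
    have h1 : X ^ n - 1 ∣ blockPoly y * g.comp (X ^ (n - 1)) := by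
      refine dvd_of_constTerm_eq_zero hn fun k => ?_
      obtain ⟨c, hc⟩ := exists_mk_blockPoly hn (g * X ^ k)
      rw [mk_eq_mk_iff] at hc
      have hgc : g ∣ blockPoly c :=
        (dvd_iff_dvd_of_dvd_sub ((Dvd.intro _ hgh).trans hc)).2 (dvd_mul_right _ _)
      rw [← H c hgc, ← constTerm_mul_comp hn, mul_assoc, ← mul_comp]
      refine constTerm_eq_of_dvd hn ?_
      rw [← mul_sub, ← sub_comp]
      refine Dvd.dvd.mul_left ?_ _
      -- Substituting `x^{n-1}` maps the ideal `⟨x^n - 1⟩` into itself.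
      rw [← dvd_neg, ← neg_comp, neg_sub]
      obtain ⟨z, hz⟩ := hc
      rw [hz, mul_comp, sub_comp, X_pow_comp, one_comp, ← pow_mul, mul_comm (n - 1) n, pow_mul]
      exact (sub_one_dvd_pow_sub_one _ _).mul_right _
    rw [← mk_eq_zero_iff, map_mul, mk_comp_eq_reverse hn, ← map_mul, mk_eq_zero_iff] at h1
    -- Multiplication by a power of `x` makes the power of `x` in `h1` a multiple of `n`.
    have h2 : X ^ n - 1 ∣ blockPoly y * g.reverse := by
      have h3 : X ^ n - 1 ∣ blockPoly y * g.reverse * (X ^ n) ^ g.natDegree := by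
        have h4 : (X ^ n : (ZMod 4)[X]) ^ g.natDegree =
            X ^ ((n - 1) * g.natDegree) * X ^ g.natDegree := by
          rw [← pow_mul, ← pow_add]
          congr 1
          rw [← Nat.succ_mul, Nat.succ_eq_add_one, Nat.sub_add_cancel hn.pos]
        rw [h4, ← mul_assoc, mul_assoc (blockPoly y)]
        exact h1.mul_right _
      have h5 := (sub_one_dvd_pow_sub_one (X ^ n : (ZMod 4)[X]) g.natDegree).mul_left
        (blockPoly y * g.reverse)
      rw [mul_sub_one] at h5
      exact (dvd_sub_right h3).1 h5
    obtain ⟨z, hz⟩ := h2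
    refine ⟨-z, ?_⟩
    apply (monic_X_pow_sub_one hn).isRegular.right
    change blockPoly y * (X ^ n - 1) = h.reverse * -z * (X ^ n - 1)
    linear_combination (-h.reverse) * hz + blockPoly y * hrev
  · rintro ⟨z, hz⟩ c ⟨p, hp⟩
    rw [← constTerm_mul_comp hn, constTerm_eq_of_dvd hn (q := 0), map_zero]
    rw [sub_zero, hp, mul_comp, ← mul_assoc]
    refine Dvd.dvd.mul_right ?_ _
    rw [← mk_eq_zero_iff, map_mul, mk_comp_eq_reverse hn, ← map_mul, mk_eq_zero_iff, hz]
    refine ⟨-(z * X ^ ((n - 1) * g.natDegree)), ?_⟩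
    linear_combination (z * X ^ ((n - 1) * g.natDegree)) * hrev

/-! ### Duality of truncation and shortening -/

/-- `ℤ₄` is an injective module over itself. -/
lemma baer_zmod_four : Module.Baer (ZMod 4) (ZMod 4) := by
  intro I g
  suffices h : ∃ y, ∀ x (hx : x ∈ I), x * y = g ⟨x, hx⟩ by
    obtain ⟨y, hy⟩ := h
    exact ⟨LinearMap.toSpanSingleton _ _ y, hy⟩
  by_cases h1 : (1 : ZMod 4) ∈ I
  · refine ⟨g ⟨1, h1⟩, fun x hx => ?_⟩
    rw [← smul_eq_mul, ← map_smul]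
    congr 1
    exact Subtype.ext (mul_one x)
  have h3 : (3 : ZMod 4) ∉ I := fun h => h1 (I.mul_mem_left 3 h)
  have hI : ∀ x ∈ I, x = 0 ∨ x = 2 := by
    intro x hx
    have : ∀ x : ZMod 4, x = 0 ∨ x = 1 ∨ x = 2 ∨ x = 3 := by decide
    rcases this x with rfl | rfl | rfl | rfl
    · exact Or.inl rfl
    · exact absurd hx h1
    · exact Or.inr rfl
    · exact absurd hx h3
  have hz : ∀ h0 : (0 : ZMod 4) ∈ I, g ⟨0, h0⟩ = 0 := fun _ => map_zero g
  by_cases h2 : (2 : ZMod 4) ∈ I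
  · have h4 : 2 * g ⟨2, h2⟩ = 0 := by
      rw [← smul_eq_mul, ← map_smul]
      exact hz (I.mul_mem_left 2 h2)
    have h5 : ∀ a : ZMod 4, 2 * a = 0 → ∃ y, 2 * y = a := by decide
    obtain ⟨y, hy⟩ := h5 _ h4
    refine ⟨y, fun x hx => ?_⟩
    rcases hI x hx with rfl | rfl
    · rw [zero_mul, hz]
    · exact hy
  · refine ⟨0, fun x hx => ?_⟩
    rcases hI x hx with rfl | rfl
    · rw [zero_mul, hz]
    · exact absurd hx h2

lemma exists_eq_dot {l : ℕ} {m : Fin l → ℕ} (φ : Word m →ₗ[ZMod 4] ZMod 4) :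
    ∃ d : Word m, ∀ c, φ c = dot d c := by
  refine ⟨fun i j => φ (Pi.single i (Pi.single j 1)), fun c => ?_⟩
  have hc : c = ∑ i, ∑ j, c i j • (Pi.single i (Pi.single j 1) : Word m) := by
    funext i j
    rw [Finset.sum_apply, Finset.sum_apply, Finset.sum_eq_single i]
    · rw [Finset.sum_apply, Finset.sum_apply, Finset.sum_eq_single j]
      · simp
      · intro k _ hk
        simp [hk.symm]
      · simp
    · intro k _ hk
      simp [Finset.sum_apply, hk.symm]
    · simp
  conv_lhs => rw [hc]
  simp only [map_sum, map_smul, smul_eq_mul, dot, mul_comm]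

/-- The `i`-th blocks of the dual codewords that vanish after block `i` form the dual of the code
of the `i`-th blocks of the codewords that vanish before block `i`. -/
lemma exists_mem_dualCode_iff {l : ℕ} {m : Fin l → ℕ} (C : Submodule (ZMod 4) (Word m)) (i : Fin l)
    (y : Fin (m i) → ZMod 4) :
    (∃ d ∈ dualCode C, (∀ j, i < j → d j = 0) ∧ d i = y) ↔
      ∀ c ∈ C, (∀ j, j < i → c j = 0) → ∑ k, y k * c i k = 0 := by
  constructor
  · rintro ⟨d, hd, h0, rfl⟩ c hc hc0
    rw [← hd c hc, dot, Finset.sum_eq_single i]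
    · intro j _ hj
      rcases lt_or_gt_of_ne hj with hj | hj
      · simp [hc0 j hj]
      · simp [h0 j hj]
    · simp
  · intro H
    -- On `C`, the functional `c ↦ -⟨y, cᵢ⟩` depends only on the blocks before `i`; injectivity
    -- of `ℤ₄` extends it to all words supported there.
    let α : C →ₗ[ZMod 4] Word m :=
      LinearMap.pi fun j => if j < i then LinearMap.proj j ∘ₗ C.subtype else 0
    let β : C →ₗ[ZMod 4] ZMod 4 :=
      -(∑ k, y k • (LinearMap.proj k ∘ₗ LinearMap.proj i ∘ₗ C.subtype))
    have hα : ∀ (c : C) j, α c j = if j < i then c.1 j else 0 := by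
      intro c j
      simp only [α, LinearMap.pi_apply]
      split_ifs <;> rfl
    have hβ : ∀ c : C, β c = -∑ k, y k * c.1 i k := by
      intro c
      simp [β]
    have hker : LinearMap.ker α ≤ LinearMap.ker β := by
      intro c hc
      rw [LinearMap.mem_ker] at hc ⊢
      rw [hβ, H c.1 c.2, neg_zero]
      intro j hj
      have := hα c j
      rw [if_pos hj, hc] at this
      exact this.symm
    obtain ⟨φ, hφ⟩ := baer_zmod_four.extension_property ((LinearMap.ker α).liftQ α le_rfl)
      (LinearMap.ker_eq_bot.1 (Submodule.ker_liftQ_eq_bot _ _ _ le_rfl)) ((LinearMap.ker α).liftQ β hker)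
    have hφα : ∀ c : C, φ (α c) = β c := fun c =>
      LinearMap.congr_fun hφ (Submodule.Quotient.mk c)
    obtain ⟨d, hd⟩ := exists_eq_dot φ
    refine ⟨fun j => if h : j = i then h ▸ y else if j < i then d j else 0, ?_, ?_, ?_⟩
    · intro c hc
      have h1 : dot d (α ⟨c, hc⟩) + ∑ k, y k * c i k = 0 := by
        rw [← hd, hφα, hβ, neg_add_cancel]
      rw [← h1, dot, dot, ← Finset.add_sum_erase _ _ (Finset.mem_univ i),
        ← Finset.add_sum_erase _ (fun j => ∑ k, d j k * α ⟨c, hc⟩ j k) (Finset.mem_univ i)]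
      have h2 : ∀ k, α ⟨c, hc⟩ i k = 0 := fun k => by
        rw [hα, if_neg (lt_irrefl i)]; rfl
      simp only [h2, mul_zero, Finset.sum_const_zero, zero_add, dif_pos]
      rw [add_comm]
      congr 1
      refine Finset.sum_congr rfl fun j hj => Finset.sum_congr rfl fun k _ => ?_
      rw [dif_neg (Finset.ne_of_mem_erase hj), hα]
      split_ifs <;> simp
    · intro j hj
      simp only
      rw [dif_neg hj.ne', if_neg hj.not_gt]
    · simp

/-! ### Leading ideals of truncated codes -/

/-- The polynomials `p` such that some codeword of `C` has `r`-th block `p` and vanishes in the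
blocks `j` with `r < j < t`. -/
def leadingPolys {l : ℕ} {m : Fin l → ℕ} (C : Submodule (ZMod 4) (Word m)) (t : ℕ) (r : Fin l) :
    Set (ZMod 4)[X] :=
  {p | ∃ c ∈ C, (∀ j : Fin l, r < j → (j : ℕ) < t → c j = 0) ∧
    toAmbient c r = Ideal.Quotient.mk _ p}

lemma mem_leadingPolys_truncatedCode {l : ℕ} {m : Fin l → ℕ} (C : Submodule (ZMod 4) (Word m))
    (i : Fin l) {t : ℕ} (ht : t ≤ i + 1) (r : Fin (i + 1)) (p : (ZMod 4)[X]) :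
    p ∈ leadingPolys (truncatedCode C i) t r ↔ p ∈ leadingPolys C t (Fin.castLE i.isLt r) := by
  constructor
  · rintro ⟨_, ⟨c, hc, rfl⟩, h0, hp⟩
    exact ⟨c, hc, fun j hj hjt => h0 ⟨j, by omega⟩ hj hjt, hp⟩
  · rintro ⟨c, hc, h0, hp⟩
    exact ⟨truncate m i c, ⟨c, hc, rfl⟩, fun j hj hjt => h0 _ hj hjt, hp⟩

namespace IsNormalizedGeneratingSet

variable {l : ℕ} {m : Fin l → ℕ} {C : Submodule (ZMod 4) (Word m)}
  {F : Fin l → Fin l → (ZMod 4)[X]}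

lemma mem_iff (hF : IsNormalizedGeneratingSet C F) (c : Word m) :
    c ∈ C ↔ toAmbient c ∈ rowSpan m F l := by
  rw [hF.generates, rowSpan]
  have : {s : Fin l | (s : ℕ) < l} = Set.univ := Set.eq_univ_of_forall Fin.isLt
  rw [this, Set.image_univ]

lemma mem_leadingPolys_iff (hF : IsNormalizedGeneratingSet C F) (hm : ∀ i, Odd (m i)) (r : Fin l)
    (p : (ZMod 4)[X]) : p ∈ leadingPolys C l r ↔ p ∈ Ideal.span {F r r, X ^ m r - 1} := by
  rw [Ideal.mem_span_pair]
  constructor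
  · rintro ⟨c, hc, h0, hp⟩
    have h1 := hF.leading r c hc fun j hj => h0 j hj j.isLt
    rw [hp, Ideal.mem_span_singleton'] at h1
    obtain ⟨a, ha⟩ := h1
    obtain ⟨a, rfl⟩ := Ideal.Quotient.mk_surjective a
    rw [← map_mul, mk_eq_mk_iff] at ha
    obtain ⟨z, hz⟩ := ha
    exact ⟨a, -z, by linear_combination hz⟩
  · rintro ⟨a, b, rfl⟩
    obtain ⟨c, hc⟩ := toAmbient_surjective hm (a • ofPolys m (F r))
    refine ⟨c, ?_, fun j hj _ => ?_, ?_⟩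
    · rw [hF.mem_iff, hc]
      exact Submodule.smul_mem _ _ (row_mem_rowSpan r.isLt)
    · rw [← toAmbient_apply_eq_zero_iff (hm j), hc, smul_ofPolys_apply, hF.lower r j hj, mul_zero,
        map_zero]
    · rw [hc, smul_ofPolys_apply, mk_eq_mk_iff]
      exact ⟨-b, by ring⟩

lemma isReduced (hF : IsNormalizedGeneratingSet C F) (hm : ∀ i, Odd (m i))
    (hdvd : ∀ r, F r r ∣ X ^ m r - 1) : IsReduced m F where
  lower := hF.lower
  dvd := hdvd
  leading r v hv h0 := by
    obtain ⟨c, rfl⟩ := toAmbient_surjective hm v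
    have h1 := hF.leading r c ((hF.mem_iff c).2 hv) fun j hj =>
      (toAmbient_apply_eq_zero_iff (hm j) c).1 (h0 j hj)
    obtain ⟨a, ha⟩ := Ideal.mem_span_singleton'.1 h1
    obtain ⟨a, rfl⟩ := Ideal.Quotient.mk_surjective a
    exact ⟨a, by rw [← ha, map_mul]⟩

/-- Statements about codewords are statements about the span of the rows. -/
lemma exists_mem_iff (hF : IsNormalizedGeneratingSet C F) (hm : ∀ i, Odd (m i))
    (S : Fin l → Prop) (r : Fin l) (p : (ZMod 4)[X]) :
    (∃ c ∈ C, (∀ j, S j → c j = 0) ∧ toAmbient c r = Ideal.Quotient.mk _ p) ↔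
      ∃ v ∈ rowSpan m F l, (∀ j, S j → v j = 0) ∧ v r = Ideal.Quotient.mk _ p := by
  constructor
  · rintro ⟨c, hc, h0, hp⟩
    exact ⟨_, (hF.mem_iff c).1 hc,
      fun j hj => (toAmbient_apply_eq_zero_iff (hm j) c).2 (h0 j hj), hp⟩
  · rintro ⟨v, hv, h0, hp⟩
    obtain ⟨c, rfl⟩ := toAmbient_surjective hm v
    exact ⟨c, (hF.mem_iff c).2 hv,
      fun j hj => (toAmbient_apply_eq_zero_iff (hm j) c).1 (h0 j hj), hp⟩

end IsNormalizedGeneratingSet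

/-- The leading ideals of the code truncated to its first `t` blocks are all generated by monic
polynomials. -/
def HasMonicLeading {l : ℕ} {m : Fin l → ℕ} (C : Submodule (ZMod 4) (Word m)) (t : ℕ) : Prop :=
  ∀ r : Fin l, (r : ℕ) < t → ∃ d : (ZMod 4)[X], d.Monic ∧ ∀ p, p ∈ leadingPolys C t r ↔ d ∣ p

section

variable {l : ℕ} {m : Fin l → ℕ} {C : Submodule (ZMod 4) (Word m)}

lemma hasMonicLeading_length (hm : ∀ i, Odd (m i)) {F : Fin l → Fin l → (ZMod 4)[X]}
    (hF : IsNormalizedGeneratingSet C F) (hFdvd : ∀ i, F i i ∣ X ^ m i - 1) :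
    HasMonicLeading C l := by
  intro r _
  have h1 : ∀ p, p ∈ leadingPolys C l r ↔ F r r ∣ p := fun p => by
    rw [hF.mem_leadingPolys_iff hm, Ideal.mem_span_pair]
    constructor
    · rintro ⟨a, b, rfl⟩
      exact dvd_add (dvd_mul_left _ _) ((hFdvd r).mul_left b)
    · rintro ⟨a, rfl⟩
      exact ⟨a, 0, by ring⟩
  rcases (hF.diag r).monic_or_monic_neg with h | h
  · exact ⟨_, h, h1⟩
  · exact ⟨_, h, fun p => by rw [h1, neg_dvd]⟩

lemma HasMonicLeading.isReduced (hm : ∀ i, Odd (m i)) {i : Fin l} (h : HasMonicLeading C (i + 1))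
    {G : Fin (i + 1) → Fin (i + 1) → (ZMod 4)[X]}
    (hG : IsNormalizedGeneratingSet (truncatedCode C i) G) : IsReduced (truncLengths m i) G := by
  refine hG.isReduced (fun _ => hm _) fun r => ?_
  obtain ⟨d, hd, hdp⟩ := h (Fin.castLE i.isLt r) r.isLt
  have h1 : ∀ p, p ∈ Ideal.span {G r r, X ^ truncLengths m i r - 1} ↔ d ∣ p := fun p => by
    rw [← hG.mem_leadingPolys_iff (fun _ => hm _), mem_leadingPolys_truncatedCode C i le_rfl, hdp]
  have hdvd : d ∣ X ^ truncLengths m i r - 1 := (h1 _).1 (Ideal.subset_span (by simp))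
  rcases (hG.diag r).eq_or_eq_neg (hm _) hd h1 with h2 | h2 <;> rw [h2]
  · exact hdvd
  · exact (neg_dvd).2 hdvd

/-- Elimination in the first `i + 1` blocks passes monic leading generators down to the first `i`
blocks. -/
lemma HasMonicLeading.step (hm : ∀ i, Odd (m i)) {i : Fin l} (h : HasMonicLeading C (i + 1))
    {G : Fin (i + 1) → Fin (i + 1) → (ZMod 4)[X]}
    (hG : IsNormalizedGeneratingSet (truncatedCode C i) G)
    {P : ℕ → Fin (i + 1) → (ZMod 4)[X]} {A B : ℕ → (ZMod 4)[X]}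
    (he : IsElimination (truncLengths m i) G (Fin.last i) P A B) : HasMonicLeading C i := by
  intro r hr
  obtain ⟨r, rfl⟩ : ∃ r' : Fin (i + 1), Fin.castLE i.isLt r' = r := ⟨⟨r, by omega⟩, rfl⟩
  obtain ⟨δ, hδ, hp⟩ := he.exists_mem_pivot_iff (h.isReduced hm hG) hr
  refine ⟨δ, hδ, fun p => ?_⟩
  have h1 := hG.exists_mem_iff (fun _ => hm _) (fun j => r < j ∧ (j : ℕ) < i) r p
  simp only [and_imp] at h1
  rw [← hp p, ← mem_leadingPolys_truncatedCode C i (Nat.le_succ i) r p, ← h1]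
  rfl

/-- If the `i`-th blocks of the codewords that vanish before block `i` form the cyclic code `⟨g⟩`,
then the leading polynomials of the dual code in block `i` are the multiples of `h^*`, where
`g h = x^{m_i} - 1`. -/
lemma mem_leadingPolys_dualCode_iff (hm : ∀ i, Odd (m i)) (i : Fin l) {g h : (ZMod 4)[X]}
    (hg : g.Monic) (hh : h.Monic) (hgh : g * h = X ^ m i - 1)
    (hC : ∀ p, (∃ c ∈ C, (∀ j, j < i → c j = 0) ∧ toAmbient c i = Ideal.Quotient.mk _ p) ↔ g ∣ p)
    (p : (ZMod 4)[X]) : p ∈ leadingPolys (dualCode C) l i ↔ h.reverse ∣ p := by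
  have key : ∀ y : Fin (m i) → ZMod 4,
      (∃ d ∈ dualCode C, (∀ j, i < j → d j = 0) ∧ d i = y) ↔ h.reverse ∣ blockPoly y := by
    intro y
    rw [exists_mem_dualCode_iff, ← cyclic_dual_iff (hm i) hg hh hgh]
    constructor
    · intro H w hw
      obtain ⟨c, hc, h0, hcw⟩ := (hC _).2 hw
      rw [← mk_blockPoly_injective (hm i) hcw]
      exact H c hc h0
    · intro H c hc h0
      exact H _ ((hC _).1 ⟨c, hc, h0, rfl⟩)
  have hdvd : h.reverse ∣ X ^ m i - 1 :=
    ⟨-g.reverse, by linear_combination reverse_mul_reverse hg hh hgh⟩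
  constructor
  · rintro ⟨d, hd, h0, hp⟩
    have h1 := (key _).1 ⟨d, hd, fun j hj => h0 j hj j.isLt, rfl⟩
    exact (dvd_iff_dvd_of_dvd_sub (hdvd.trans (mk_eq_mk_iff.1 hp))).1 h1
  · intro hp
    obtain ⟨y, hy⟩ := exists_mk_blockPoly (hm i) p
    obtain ⟨d, hd, h0, rfl⟩ := (key y).2
      ((dvd_iff_dvd_of_dvd_sub (hdvd.trans (mk_eq_mk_iff.1 hy))).2 hp)
    exact ⟨d, hd, fun j hj _ => h0 j hj, hy⟩

end

end GQC

theorem proposition4 {l : ℕ} (m : Fin l → ℕ) (hm : ∀ i, Odd (m i))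
    (C : Submodule (ZMod 4) (GQC.Word m)) (hC : GQC.IsGQC C)
    (F : Fin l → Fin l → (ZMod 4)[X]) (hF : GQC.IsNormalizedGeneratingSet C F)
    (E : Fin l → Fin l → (ZMod 4)[X])
    (hE : GQC.IsNormalizedGeneratingSet (GQC.dualCode C) E)
    (G : (i : Fin l) → Fin (i + 1) → Fin (i + 1) → (ZMod 4)[X])
    (hG : ∀ i, GQC.IsNormalizedGeneratingSet (GQC.truncatedCode C i) (G i))
    (hGdiag : ∀ i r, GQC.MonicNoMultipleRoots (G i r r))
    (P : (i : Fin l) → ℕ → Fin (i + 1) → (ZMod 4)[X])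
    (A B : Fin l → ℕ → (ZMod 4)[X])
    (helim : ∀ i, GQC.IsElimination (GQC.truncLengths m i) (G i) (Fin.last i) (P i) (A i) (B i))
    (hFdvd : ∀ i, F i i ∣ X ^ m i - 1)
    (hGk : ∀ (i : Fin l) (k : ℕ), k < (i : ℕ) →
      GQC.MonicNoMultipleRoots (P i k (GQC.pivot (Fin.last i) k))) :
    ∀ i : Fin l,
      E i i * (GQC.elimDiagonal (Fin.last i) (A i)).reverse = X ^ m i - 1 ∨
      E i i * (GQC.elimDiagonal (Fin.last i) (A i)).reverse = 1 - X ^ m i := by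
  intro i
  have hlead : ∀ t ≤ l, GQC.HasMonicLeading C t := fun t ht =>
    Nat.decreasingInduction' (P := fun t => GQC.HasMonicLeading C t)
      (fun k hk _ h => h.step (i := ⟨k, hk⟩) hm (hG _) (helim _)) ht
      (GQC.hasMonicLeading_length hm hF hFdvd)
  have hred := (hlead (i + 1) i.isLt).isReduced hm (hG i)
  have hiff := (helim i).exists_mem_last_iff hred
  obtain ⟨h, hgh⟩ := (helim i).elimDiagonal_dvd hred
  have hg : (GQC.elimDiagonal (Fin.last i) (A i)).Monic := by
    refine monic_prod_of_monic _ _ fun k hk => ?_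
    rcases k with _ | k
    · rw [(helim i).A_zero]
      exact (hGdiag i _).1
    · have hk' : k < (i : ℕ) := by simpa using hk
      obtain ⟨δ, hδ, -, hA, -⟩ := (helim i).exists_coprime hk'
      exact hδ.of_mul_monic_right (hA ▸ (hGdiag i _).1)
  set g := GQC.elimDiagonal (Fin.last i) (A i)
  have hgh' : g * h = X ^ m i - 1 := hgh.symm
  have hh : h.Monic := hg.of_mul_monic_left (hgh' ▸ GQC.monic_X_pow_sub_one (hm i))
  have hker : ∀ p, (∃ c ∈ C, (∀ j, j < i → c j = 0) ∧
      GQC.toAmbient c i = Ideal.Quotient.mk _ p) ↔ g ∣ p := by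
    intro p
    rw [← hiff p]
    refine Iff.trans ?_ ((hG i).exists_mem_iff (fun _ => hm _)
      (fun j => (j : ℕ) < i) (Fin.last i) p)
    constructor
    · rintro ⟨c, hc, h0, hp⟩
      exact ⟨GQC.truncate m i c, ⟨c, hc, rfl⟩, fun j hj => h0 _ hj, hp⟩
    · rintro ⟨_, ⟨c, hc, rfl⟩, h0, hp⟩
      exact ⟨c, hc, fun j hj => h0 ⟨j, by omega⟩ hj, hp⟩
  have hdual : ∀ p, p ∈ Ideal.span {E i i, X ^ m i - 1} ↔ h.reverse ∣ p := fun p => by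
    rw [← hE.mem_leadingPolys_iff hm, GQC.mem_leadingPolys_dualCode_iff hm i hg hh hgh' hker]
  have hrev := GQC.reverse_mul_reverse hg hh hgh'
  have hEh : E i i = h.reverse ∨ E i i = -h.reverse := by
    rcases GQC.monic_reverse_or_monic_neg_reverse (hm i) hgh' with h1 | h1
    · exact (hE.diag i).eq_or_eq_neg (hm i) h1 hdual
    · rw [← neg_neg h.reverse, neg_neg (-h.reverse), or_comm]
      exact (hE.diag i).eq_or_eq_neg (hm i) h1 fun p => by rw [hdual, neg_dvd]
  rcases hEh with h1 | h1 <;> rw [h1]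
  · right; linear_combination hrev
  · left; linear_combination (-1 : (ZMod 4)[X]) * hrev
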